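/- Let $(a)_0=1$ and $(a)_k=a(a+1)\cdots(a+k-1)$ for $k\ge 1$. For $\alpha,\beta>-1$, an integer $N\ge 0$ and $n\in\{0,\dots,N\}$, the Hahn polynomials are $$Q_n(x,\alpha,\beta,N)=\sum_{k=0}^{n}\frac{(-n)_k\,(n+\alpha+\beta+1)_k\,(-x)_k}{k!\,(\alpha+1)_k\,(-N)_k}.$$ (The same formula is used for real $N\notin\{0,1,\dots,n-1\}$.) Let $T_n(x,N)=Q_n(x,-\tfrac12,-\tfrac12,N)$ and $U_n(x,N)=Q_n(x,\tfrac12,\tfrac12,N)$ be the discrete Chebyshev polynomials of the first and second kind. Then for every integer $N\ge 0$ and every real $x\in[0,N]$ the following hold. (a) For $n=0,\dots,N-1$, $$-x\Bigl(1-\frac xN\Bigr)\sum_{\ell=0}^{n-1}(\ell+1)\Bigl\{\frac{4(\ell+1)}{N-1}\,U_\ell(x-1,N-2)\Bigr\}^2+T_{n+1}(x,N)^2+\frac xN\Bigl(1-\frac xN\Bigr)\Bigl\{\frac{2(n+1)(N-n-1)}{N-1}\,U_n(x-1,N-2)\Bigr\}^2=1,$$ where for $n=N-1$ the expression $\frac{N-n-1}{N-1}U_n(x-1,N-2)$,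 which is then not defined as it stands, denotes the limit $\lim_{M\to N}\frac{M-n-1}{M-1}U_n(x-1,M-2)$ over real $M\ne N$ (this limit exists). (b) For $n=0,\dots,N-1$, $$|T_n(x,N)|\le\prod_{j=1}^{n-1}\Bigl(1+\frac{n}{N-n+j}\Bigr),$$ where an empty product is $1$. (c) For every integer $n$ with $0\le n\le N$ and $n\le\sqrt{N+1}$, $$|U_n(x,N)|\le 1.$$ -/

import Mathlib

open Filter Topology

/-- The Hahn polynomial `Q_n(x, α, β, N)`, a terminating `₃F₂` at `1`, with `(a)_k` the rising
factorial `a (a + 1) ⋯ (a + k - 1)`. For a natural number `N` it is meant for `n ≤ N` only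
(otherwise some `(-N)_k` in the denominator vanishes); `N` is a real number here so that
values such as `N - 2` and limits in `N` can be written. -/
noncomputable def hahnQ (n : ℕ) (x α β N : ℝ) : ℝ :=
  ∑ k ∈ Finset.range (n + 1),
    ((ascPochhammer ℝ k).eval (-(n : ℝ)) * (ascPochhammer ℝ k).eval ((n : ℝ) + α + β + 1)
        * (ascPochhammer ℝ k).eval (-x))
      / ((k.factorial : ℝ) * (ascPochhammer ℝ k).eval (α + 1) * (ascPochhammer ℝ k).eval (-N))

/-- The discrete Chebyshev polynomial of the first kind, `T_n(x, N)`. -/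
noncomputable def discreteChebyshevT (n : ℕ) (x N : ℝ) : ℝ :=
  hahnQ n x (-1 / 2) (-1 / 2) N

/-- The discrete Chebyshev polynomial of the second kind, `U_n(x, N)`. -/
noncomputable def discreteChebyshevU (n : ℕ) (x N : ℝ) : ℝ :=
  hahnQ n x (1 / 2) (1 / 2) N

/-! Put `y = 1 - 2x/N` and pair `Q_n(x, α, α, N)` with its companion `u_n = Q_{n-1}(x-1, α+1, α+1,
N-2)`. As for classical Chebyshev polynomials, `Q_{n+1} = y Q_n - (1 - y²) p u_n` and `q' u_{n+1} =
Q_n + y p u_n` (`hahnQ_succ_succ`, `hahnQ_shift_succ`). Hence `Q_{n+1}² + (1 - y²)(q' u_{n+1})² =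
Q_n² + (1 - y²)(p u_n)²`. Classically the incoming weight `p` equals the weight `q` left by the
previous step, and the quadratic form stays 1. Here they differ. For `α = -1/2`, `p = n(N+n)/(N-1)`
and `q = n(N-n)/(N-1)`: accumulating `p² - q²` gives (a), and multiplying the ratios `p/q` gives
(b). For `α = 1/2`, `p ≤ q` as long as `(n+1)² ≤ N+1`, so the form does not grow, which is (c). -/

/-- The coefficient `(a)_k (b)_k / (k! (e)_k (f)_k)` of a `₃F₂` series at `1`. -/
noncomputable def hypCoeff (a b e f : ℝ) (k : ℕ) : ℝ :=
  ((ascPochhammer ℝ k).eval a * (ascPochhammer ℝ k).eval b)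
    / ((k.factorial : ℝ) * (ascPochhammer ℝ k).eval e * (ascPochhammer ℝ k).eval f)

theorem hypCoeff_zero (a b e f : ℝ) : hypCoeff a b e f 0 = 1 := by
  simp [hypCoeff]

theorem hypCoeff_succ (a b e f : ℝ) (k : ℕ) :
    hypCoeff a b e f (k + 1) =
      hypCoeff a b e f k * ((a + k) * (b + k) / ((k + 1) * (e + k) * (f + k))) := by
  simp only [hypCoeff, ascPochhammer_succ_eval, Nat.factorial_succ]
  push_cast
  rw [div_mul_div_comm]
  congr 1 <;> ring

theorem hahnQ_eq_sum (n : ℕ) (x α β N : ℝ) :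
    hahnQ n x α β N = ∑ k ∈ Finset.range (n + 1),
      hypCoeff (-n) (n + α + β + 1) (α + 1) (-N) k * (ascPochhammer ℝ k).eval (-x) := by
  unfold hahnQ hypCoeff
  refine Finset.sum_congr rfl fun k _ => ?_
  ring

theorem hahnQ_zero (x α β N : ℝ) : hahnQ 0 x α β N = 1 := by
  simp [hahnQ]

theorem hahnQ_one (x α N : ℝ) (hα : α + 1 ≠ 0) (hN : N ≠ 0) :
    hahnQ 1 x α α N = 1 - 2 * x / N := by
  simp [hahnQ, Finset.sum_range_succ]
  field_simp
  ring

/-- Contiguity in the first two parameters. -/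
theorem hypCoeff_pred_succ (a b e f : ℝ) (hb : b ≠ 0) (k : ℕ) :
    hypCoeff (a - 1) (b + 1) e f (k + 1) = hypCoeff a b e f k *
      ((a - 1) * (b + k) * (b + k + 1) / (b * (k + 1) * (e + k) * (f + k))) := by
  induction k with
  | zero =>
    simp only [hypCoeff_succ, hypCoeff_zero]
    push_cast
    field_simp
    ring
  | succ k ih =>
    rw [hypCoeff_succ, ih, hypCoeff_succ a b]
    push_cast
    simp only [div_eq_mul_inv, mul_inv]
    ring

/-- Contiguity under the shift that `x ↦ x - 1` requires. -/
theorem hypCoeff_shift (a b e f : ℝ) (ha : a ≠ 0) (hb : b ≠ 0) (he : e ≠ 0) (hf : f ≠ 0)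
    (hf' : f + 1 ≠ 0) (k : ℕ) :
    hypCoeff (a + 1) (b + 1) (e + 1) (f + 2) k = hypCoeff a b e f k *
      ((a + k) * (b + k) * e * f * (f + 1) /
        (a * b * (e + k) * (f + k) * (f + k + 1))) := by
  induction k with
  | zero =>
    simp only [hypCoeff_zero, Nat.cast_zero, add_zero, one_mul]
    field_simp
  | succ k ih =>
    rw [hypCoeff_succ, ih, hypCoeff_succ a b]
    push_cast
    simp only [div_eq_mul_inv, mul_inv]
    ring

theorem ascPochhammer_eval_succ_left (a : ℝ) (k : ℕ) :
    (ascPochhammer ℝ (k + 1)).eval a = a * (ascPochhammer ℝ k).eval (a + 1) := by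
  rw [ascPochhammer_succ_left]
  simp [Polynomial.eval_comp]

/-! ### Telescoping of the hypergeometric sums behind both recurrences. -/

/-- Partial sums of the first recurrence. -/
theorem partial_sum_first (a b e f x : ℝ) (ha : a ≠ 0) (hb : b ≠ 0) (he : 2 * e = a + b + 1)
    (K : ℕ) (heK : ∀ j ≤ K, e + (j : ℝ) ≠ 0) (hfK : ∀ j ≤ K, f + (j : ℝ) ≠ 0) :
    ∑ k ∈ Finset.range (K + 1),
        hypCoeff (a - 1) (b + 1) e f k * (ascPochhammer ℝ k).eval (-x)
      - (1 + 2 * x / f) * ∑ k ∈ Finset.range K,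
        hypCoeff a b e f k * (ascPochhammer ℝ k).eval (-x)
      + (1 - (1 + 2 * x / f) ^ 2) * (a * (b - f) / (2 * e * (f + 1))) * ∑ k ∈ Finset.range K,
        hypCoeff (a + 1) (b + 1) (e + 1) (f + 2) k * (ascPochhammer ℝ k).eval (-x + 1)
      = hypCoeff a b e f K * (ascPochhammer ℝ K).eval (-x) *
        ((1 + 2 * K / f) - 2 * (b - f) / (f * b) * K / (f + K) * (K - x)) := by
  induction K with
  | zero => simp [hypCoeff_zero]
  | succ K ih =>
    have ih := ih (fun j hj => heK j (by omega)) (fun j hj => hfK j (by omega))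
    have h0 := hfK 0 (by omega)
    have h1 := hfK 1 (by omega)
    have hK := hfK K (by omega)
    have hK1 := hfK (K + 1) le_rfl
    have e0 := heK 0 (by omega)
    have eK := heK K (by omega)
    have k0 : (K : ℝ) + 1 ≠ 0 := by positivity
    push_cast at h0 h1 hK hK1 e0 eK
    rw [add_zero] at h0 e0
    have hP := ascPochhammer_eval_succ_left (-x) K
    have hP' := ascPochhammer_succ_eval (S := ℝ) K (-x)
    simp only [Finset.sum_range_succ] at ih ⊢
    rw [hypCoeff_pred_succ a b e f hb, hypCoeff_shift a b e f ha hb e0 h0 h1, hypCoeff_succ a b]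
    rw [hP'] at hP ⊢
    set P := (ascPochhammer ℝ K).eval (-x)
    set P' := (ascPochhammer ℝ K).eval (-x + 1)
    set q := hypCoeff a b e f K
    -- The factor `1 - y²` supplies the `-x` that turns `(1-x)_K` into `(-x)_{K+1}`.
    have hs : (1 - (1 + 2 * x / f) ^ 2) * P' = 4 * (f + x) / f ^ 2 * (P * (-x + K)) := by
      rw [hP]; field_simp; ring
    obtain rfl : a = 2 * e - b - 1 := by linarith
    push_cast
    have hK2 : f + K + 1 ≠ 0 := by rwa [add_assoc]
    have key : q * ((2 * e - b - 1 - 1) * (b + K) * (b + K + 1) / (b * (K + 1) * (e + K) * (f + K)))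
          * (P * (-x + K)) - (1 + 2 * x / f) * (q * P)
        + (2 * e - b - 1) * (b - f) / (2 * e * (f + 1)) * (q * ((2 * e - b - 1 + K) * (b + K) * e * f
          * (f + 1) / ((2 * e - b - 1) * b * (e + K) * (f + K) * (f + K + 1))))
          * (4 * (f + x) / f ^ 2 * (P * (-x + K)))
        = q * ((2 * e - b - 1 + K) * (b + K) / ((K + 1) * (e + K) * (f + K))) * (P * (-x + K)) *
          (1 + 2 * (K + 1) / f - 2 * (b - f) / (f * b) * (K + 1) / (f + (K + 1)) * (K + 1 - x))
        - q * P * (1 + 2 * K / f - 2 * (b - f) / (f * b) * K / (f + K) * (K - x)) := by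
      rw [← add_assoc f]
      field_simp
      ring
    linear_combination ih + key + (2 * e - b - 1) * (b - f) / (2 * e * (f + 1)) *
      (q * ((2 * e - b - 1 + K) * (b + K) * e * f * (f + 1) / ((2 * e - b - 1) * b * (e + K) * (f + K) * (f + K + 1)))) * hs

set_option maxRecDepth 4000 in
/-- Partial sums of the second recurrence. -/
theorem partial_sum_second (a b e f x : ℝ) (ha : a ≠ 0) (hb : b ≠ 0) (ha1 : a - 1 ≠ 0)
    (hb1 : b + 1 ≠ 0) (he : 2 * e = a + b + 1)
    (K : ℕ) (heK : ∀ j ≤ K + 1, e + (j : ℝ) ≠ 0) (hfK : ∀ j ≤ K + 1, f + (j : ℝ) ≠ 0) :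
    (b + 1) * (f + 1 - a) / (2 * e * (f + 1)) * ∑ k ∈ Finset.range (K + 1),
        hypCoeff a (b + 2) (e + 1) (f + 2) k * (ascPochhammer ℝ k).eval (-x + 1)
      - ∑ k ∈ Finset.range (K + 1),
        hypCoeff a b e f k * (ascPochhammer ℝ k).eval (-x)
      - (1 + 2 * x / f) * (a * (b - f) / (2 * e * (f + 1))) * ∑ k ∈ Finset.range K,
        hypCoeff (a + 1) (b + 1) (e + 1) (f + 2) k * (ascPochhammer ℝ k).eval (-x + 1)
      = (a * (b - f) / (2 * e * (f + 1)) * (1 + 2 * (K + 1) / f) *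
          hypCoeff (a + 1) (b + 1) (e + 1) (f + 2) K
        - (K + 1) * hypCoeff a b e f (K + 1)) * (ascPochhammer ℝ K).eval (-x + 1) := by
  induction K with
  | zero =>
    have h0 := hfK 0 (by omega)
    have h1 := hfK 1 (by omega)
    have e0 := heK 0 (by omega)
    push_cast at h0 h1 e0
    rw [add_zero] at h0 e0
    simp [hypCoeff_zero, hypCoeff_succ]
    obtain rfl : a = 2 * e - b - 1 := by linarith
    field_simp
    ring
  | succ K ih =>
    have ih := ih (fun j hj => heK j (by omega)) (fun j hj => hfK j (by omega))
    have h0 := hfK 0 (by omega)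
    have h1 := hfK 1 (by omega)
    have hK := hfK K (by omega)
    have hK1 := hfK (K + 1) (by omega)
    have hK2 := hfK (K + 1 + 1) le_rfl
    have e0 := heK 0 (by omega)
    have eK := heK K (by omega)
    have eK1 := heK (K + 1) (by omega)
    have k0 : (K : ℝ) + 1 ≠ 0 := by positivity
    have k1 : (K : ℝ) + 1 + 1 ≠ 0 := by positivity
    push_cast at h0 h1 hK hK1 hK2 e0 eK eK1
    rw [add_zero] at h0 e0
    have hP := ascPochhammer_eval_succ_left (-x) K
    have hP' := ascPochhammer_succ_eval (S := ℝ) K (-x + 1)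
    -- The parameters `(a, b + 2)` are the shift of `(a - 1, b + 1)`.
    have hd : hypCoeff a (b + 2) (e + 1) (f + 2) (K + 1) = hypCoeff (a - 1) (b + 1) e f (K + 1) *
        ((a - 1 + (K + 1)) * (b + 1 + (K + 1)) * e * f * (f + 1) /
        ((a - 1) * (b + 1) * (e + (K + 1)) * (f + (K + 1)) * (f + (K + 1) + 1))) := by
      have := hypCoeff_shift (a - 1) (b + 1) e f ha1 hb1 e0 h0 h1 (K + 1)
      rw [sub_add_cancel, add_assoc b, one_add_one_eq_two] at this
      exact_mod_cast this
    have key : (b + 1) * (f + 1 - a) / (2 * e * (f + 1)) *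
          hypCoeff a (b + 2) (e + 1) (f + 2) (K + 1) * (-x + 1 + K)
        - hypCoeff a b e f (K + 1) * -x
        - (1 + 2 * x / f) * (a * (b - f) / (2 * e * (f + 1))) *
          hypCoeff (a + 1) (b + 1) (e + 1) (f + 2) K
        = (a * (b - f) / (2 * e * (f + 1)) * (1 + 2 * (K + 1 + 1) / f) *
            hypCoeff (a + 1) (b + 1) (e + 1) (f + 2) (K + 1)
          - (K + 1 + 1) * hypCoeff a b e f (K + 1 + 1)) * (-x + 1 + K)
        - (a * (b - f) / (2 * e * (f + 1)) * (1 + 2 * (K + 1) / f) *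
            hypCoeff (a + 1) (b + 1) (e + 1) (f + 2) K
          - (K + 1) * hypCoeff a b e f (K + 1)) := by
      rw [hd, hypCoeff_pred_succ a b e f hb, hypCoeff_shift a b e f ha hb e0 h0 h1,
        hypCoeff_shift a b e f ha hb e0 h0 h1]
      simp only [hypCoeff_succ a b e f]
      generalize hypCoeff a b e f K = q
      obtain rfl : a = 2 * e - b - 1 := by linarith
      push_cast
      rw [← add_assoc] at hK1 hK2 eK1
      rw [← add_assoc] at hK2
      simp only [← add_assoc]
      field_simp
      ring
    simp only [Finset.sum_range_succ] at ih ⊢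
    rw [hP, hP']
    push_cast
    generalize (b + 1) * (f + 1 - a) / (2 * e * (f + 1)) = A at *
    generalize a * (b - f) / (2 * e * (f + 1)) = B at *
    generalize (1 + 2 * x / f) = y at *
    linear_combination ih + (ascPochhammer ℝ K).eval (-x + 1) * key

theorem hypCoeff_neg_nat_succ (n : ℕ) (b e f : ℝ) : hypCoeff (-(n : ℝ)) b e f (n + 1) = 0 := by
  simp [hypCoeff_succ]

theorem hypCoeff_neg_nat_shift (n : ℕ) (b e f : ℝ) :
    hypCoeff (-((n + 1 : ℕ) : ℝ) + 1) b e f (n + 1) = 0 := by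
  simp [hypCoeff_succ]

/-! ### The two recurrences for Hahn polynomials and their Chebyshev cases. -/

/-- `Q_{n+1}` in terms of `Q_n` and its companion with shifted parameters. -/
theorem hahnQ_succ_succ (m : ℕ) (x α N : ℝ) (hα : -1 < α) (hN : ∀ j ≤ m + 1, N ≠ (j : ℝ)) :
    hahnQ (m + 2) x α α N = (1 - 2 * x / N) * hahnQ (m + 1) x α α N
      - (1 - (1 - 2 * x / N) ^ 2) * ((m + 1) * (N + m + 2 * α + 2) / (2 * (α + 1) * (N - 1))) *
        hahnQ m (x - 1) (α + 1) (α + 1) (N - 2) := by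
  have hm : (0 : ℝ) ≤ m := Nat.cast_nonneg m
  have hb : (m : ℝ) + 2 * α + 2 ≠ 0 := by linarith
  have hN0 : N ≠ 0 := by simpa using hN 0 (by omega)
  have hN1 : N - 1 ≠ 0 := sub_ne_zero.2 (by simpa using hN 1 (by omega))
  have hα1 : α + 1 ≠ 0 := by linarith
  have hαm : α + 1 + (m + 1) ≠ 0 := by linarith
  have hNm : -N + (m + 1) ≠ 0 := fun h => hN (m + 1) le_rfl (by push_cast; linarith)
  -- Stopping at `K = m + 1` keeps the case `N = m + 2` available, needed at the top degree; the
  -- remaining top terms cancel in `hend`.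
  have key := partial_sum_first (-((m + 1 : ℕ) : ℝ)) (m + 2 * α + 2) (α + 1) (-N) x
    (by push_cast; linarith) hb (by push_cast; ring) (m + 1)
    (fun j _ => by have : (0 : ℝ) ≤ j := Nat.cast_nonneg j
                   linarith)
    (fun j hj h => hN j hj (by linarith))
  have last := hypCoeff_pred_succ (-((m + 1 : ℕ) : ℝ)) (m + 2 * α + 2) (α + 1) (-N) hb (m + 1)
  rw [hahnQ_eq_sum, hahnQ_eq_sum, hahnQ_eq_sum, Finset.sum_range_succ]
  rw [show (-((m + 2 : ℕ) : ℝ)) = -((m + 1 : ℕ) : ℝ) - 1 by push_cast; ring,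
    show ((m + 2 : ℕ) : ℝ) + α + α + 1 = m + 2 * α + 2 + 1 by push_cast; ring,
    show ((m + 1 : ℕ) : ℝ) + α + α + 1 = m + 2 * α + 2 by push_cast; ring,
    show (m : ℝ) + (α + 1) + (α + 1) + 1 = m + 2 * α + 2 + 1 by ring,
    show -(m : ℝ) = -((m + 1 : ℕ) : ℝ) + 1 by push_cast; ring,
    show -(N - 2) = -N + 2 by ring, show -(x - 1) = -x + 1 by ring, last,
    ascPochhammer_succ_eval (m + 1), Finset.sum_range_succ (fun k =>
      hypCoeff (-((m + 1 : ℕ) : ℝ)) (m + 2 * α + 2) (α + 1) (-N) k *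
        (ascPochhammer ℝ k).eval (-x)) (m + 1)]
  generalize hypCoeff (-((m + 1 : ℕ) : ℝ)) (m + 2 * α + 2) (α + 1) (-N) (m + 1) = q at *
  generalize (ascPochhammer ℝ (m + 1)).eval (-x) = P at *
  have hend : q * ((-((m + 1 : ℕ) : ℝ) - 1) * (m + 2 * α + 2 + (m + 1 : ℕ))
        * (m + 2 * α + 2 + (m + 1 : ℕ) + 1) / ((m + 2 * α + 2) * ((m + 1 : ℕ) + 1)
        * (α + 1 + (m + 1 : ℕ)) * (-N + (m + 1 : ℕ)))) * (P * (-x + (m + 1 : ℕ)))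
      - (1 - 2 * x / N) * (q * P)
      + q * P * ((1 + 2 * (m + 1 : ℕ) / (-N)) - 2 * (m + 2 * α + 2 - -N) / (-N * (m + 2 * α + 2))
        * (m + 1 : ℕ) / (-N + (m + 1 : ℕ)) * ((m + 1 : ℕ) - x)) = 0 := by
    push_cast
    have : (m : ℝ) + 1 + 1 ≠ 0 := by linarith
    field_simp
    ring
  have hy : 1 + 2 * x / -N = 1 - 2 * x / N := by rw [div_neg]; ring
  have hB : -((m + 1 : ℕ) : ℝ) * (m + 2 * α + 2 - -N) / (2 * (α + 1) * (-N + 1))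
      = (m + 1) * (N + m + 2 * α + 2) / (2 * (α + 1) * (N - 1)) := by
    have : -N + 1 ≠ 0 := fun h => hN1 (by linarith)
    push_cast
    field_simp
    ring
  rw [hy, hB] at key
  linear_combination key + hend

/-- The companion of `Q_{n+1}` in terms of `Q_n` and its companion. -/
theorem hahnQ_shift_succ (m : ℕ) (x α N : ℝ) (hα : -1 < α) (hN : ∀ j ≤ m + 2, N ≠ (j : ℝ)) :
    (m + 2 * α + 3) * (N - m - 2) / (2 * (α + 1) * (N - 1)) *
        hahnQ (m + 1) (x - 1) (α + 1) (α + 1) (N - 2) = hahnQ (m + 1) x α α N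
      + (1 - 2 * x / N) * ((m + 1) * (N + m + 2 * α + 2) / (2 * (α + 1) * (N - 1))) *
        hahnQ m (x - 1) (α + 1) (α + 1) (N - 2) := by
  have hm : (0 : ℝ) ≤ m := Nat.cast_nonneg m
  have hN1 : N - 1 ≠ 0 := sub_ne_zero.2 (by simpa using hN 1 (by omega))
  have hα1 : α + 1 ≠ 0 := by linarith
  have key := partial_sum_second (-((m + 1 : ℕ) : ℝ)) (m + 2 * α + 2) (α + 1) (-N) x
    (by push_cast; linarith) (by linarith) (by push_cast; linarith) (by linarith)
    (by push_cast; ring) (m + 1)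
    (fun j _ => by have : (0 : ℝ) ≤ j := Nat.cast_nonneg j
                   linarith)
    (fun j hj h => hN j hj (by linarith))
  -- Both series have terminated, so the boundary term vanishes.
  rw [hypCoeff_neg_nat_succ, hypCoeff_neg_nat_shift, mul_zero, mul_zero, sub_zero, zero_mul] at key
  rw [hahnQ_eq_sum, hahnQ_eq_sum, hahnQ_eq_sum]
  rw [show ((m + 1 : ℕ) : ℝ) + α + α + 1 = m + 2 * α + 2 by push_cast; ring,
    show ((m + 1 : ℕ) : ℝ) + (α + 1) + (α + 1) + 1 = m + 2 * α + 2 + 2 by push_cast; ring,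
    show (m : ℝ) + (α + 1) + (α + 1) + 1 = m + 2 * α + 2 + 1 by ring,
    show -(m : ℝ) = -((m + 1 : ℕ) : ℝ) + 1 by push_cast; ring,
    show -(N - 2) = -N + 2 by ring, show -(x - 1) = -x + 1 by ring]
  have hN1' : -N + 1 ≠ 0 := fun h => hN1 (by linarith)
  have hy : 1 + 2 * x / -N = 1 - 2 * x / N := by rw [div_neg]; ring
  have hB : -((m + 1 : ℕ) : ℝ) * (m + 2 * α + 2 - -N) / (2 * (α + 1) * (-N + 1))
      = (m + 1) * (N + m + 2 * α + 2) / (2 * (α + 1) * (N - 1)) := by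
    push_cast
    field_simp
    ring
  have hA : (m + 2 * α + 2 + 1) * (-N + 1 - -((m + 1 : ℕ) : ℝ)) / (2 * (α + 1) * (-N + 1))
      = (m + 2 * α + 3) * (N - m - 2) / (2 * (α + 1) * (N - 1)) := by
    push_cast
    field_simp
    ring
  rw [hy, hB, hA] at key
  linear_combination key

theorem discreteChebyshevT_zero (x N : ℝ) : discreteChebyshevT 0 x N = 1 := hahnQ_zero ..

theorem discreteChebyshevU_zero (x N : ℝ) : discreteChebyshevU 0 x N = 1 := hahnQ_zero ..

theorem discreteChebyshevT_one (x N : ℝ) (hN : N ≠ 0) :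
    discreteChebyshevT 1 x N = 1 - 2 * x / N := hahnQ_one _ _ _ (by norm_num) hN

theorem discreteChebyshevU_one (x N : ℝ) (hN : N ≠ 0) :
    discreteChebyshevU 1 x N = 1 - 2 * x / N := hahnQ_one _ _ _ (by norm_num) hN

theorem discreteChebyshevT_succ_succ (m : ℕ) (x N : ℝ) (hN : ∀ j ≤ m + 1, N ≠ (j : ℝ)) :
    discreteChebyshevT (m + 2) x N = (1 - 2 * x / N) * discreteChebyshevT (m + 1) x N
      - (1 - (1 - 2 * x / N) ^ 2) * ((m + 1) * (N + m + 1) / (N - 1)) *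
        discreteChebyshevU m (x - 1) (N - 2) := by
  have h := hahnQ_succ_succ m x (-1 / 2) N (by norm_num) hN
  rw [show (-1 / 2 : ℝ) + 1 = 1 / 2 by norm_num,
    show N + m + 2 * (-1 / 2 : ℝ) + 2 = N + m + 1 by ring,
    show 2 * (1 / 2 : ℝ) * (N - 1) = N - 1 by ring] at h
  exact h

theorem discreteChebyshevU_shift_succ (m : ℕ) (x N : ℝ) (hN : ∀ j ≤ m + 2, N ≠ (j : ℝ)) :
    (m + 2) * (N - m - 2) / (N - 1) * discreteChebyshevU (m + 1) (x - 1) (N - 2) =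
      discreteChebyshevT (m + 1) x N + (1 - 2 * x / N) * ((m + 1) * (N + m + 1) / (N - 1)) *
        discreteChebyshevU m (x - 1) (N - 2) := by
  have h := hahnQ_shift_succ m x (-1 / 2) N (by norm_num) hN
  rw [show (-1 / 2 : ℝ) + 1 = 1 / 2 by norm_num,
    show N + m + 2 * (-1 / 2 : ℝ) + 2 = N + m + 1 by ring,
    show m + 2 * (-1 / 2 : ℝ) + 3 = m + 2 by ring,
    show 2 * (1 / 2 : ℝ) * (N - 1) = N - 1 by ring] at h
  exact h

theorem ascPochhammer_eval_ne_zero (a : ℝ) (k : ℕ) (h : ∀ j < k, a + (j : ℝ) ≠ 0) :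
    (ascPochhammer ℝ k).eval a ≠ 0 := by
  induction k with
  | zero => simp
  | succ k ih =>
    rw [ascPochhammer_succ_eval]
    exact mul_ne_zero (ih fun j hj => h j (by omega)) (h k (by omega))

theorem continuousAt_hahnQ (n : ℕ) (x α N : ℝ) (hα : -1 < α) (hN : ∀ j < n, N ≠ (j : ℝ)) :
    ContinuousAt (fun M => hahnQ n x α α M) N := by
  unfold hahnQ
  refine tendsto_finsetSum _ fun k hk => ?_
  have hk := Finset.mem_range.1 hk
  refine ContinuousAt.div (by fun_prop) (by fun_prop) ?_
  refine mul_ne_zero (mul_ne_zero (by positivity) (ascPochhammer_eval_ne_zero _ _ fun j _ => ?_))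
    (ascPochhammer_eval_ne_zero _ _ fun j hj h => hN j (by omega) (by linarith))
  have : (0 : ℝ) ≤ j := Nat.cast_nonneg j
  linarith

/-! ### The sum of squares identity and its limiting case. -/

/-- The sum of squares identity propagates along the recurrences; `w` is the next companion. -/
theorem sq_identity_step {S T T' w u N x n : ℝ} (hN : N ≠ 0) (hN1 : N - 1 ≠ 0)
    (hT : T' = (1 - 2 * x / N) * T - (1 - (1 - 2 * x / N) ^ 2) * (n * (N + n) / (N - 1)) * u)
    (hw : w = T + (1 - 2 * x / N) * (n * (N + n) / (N - 1)) * u)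
    (h : -x * (1 - x / N) * S + T ^ 2
      + x / N * (1 - x / N) * (2 * n * (N - n) / (N - 1) * u) ^ 2 = 1) :
    -x * (1 - x / N) * (S + n * (4 * n / (N - 1) * u) ^ 2) + T' ^ 2
      + x / N * (1 - x / N) * (2 * w) ^ 2 = 1 := by
  -- The scalings `x = N t` and `u = (N - 1) v` remove all denominators.
  obtain ⟨t, rfl⟩ : ∃ t, x = N * t := ⟨x / N, by field_simp⟩
  obtain ⟨v, rfl⟩ : ∃ v, u = (N - 1) * v := ⟨u / (N - 1), by field_simp⟩
  have hc : ∀ c : ℝ, c / (N - 1) * ((N - 1) * v) = c * v := fun c => by field_simp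
  have hy : 1 - 2 * (N * t) / N = 1 - 2 * t := by field_simp
  rw [hy, mul_assoc, hc] at hT hw
  rw [mul_div_cancel_left₀ t hN, hc] at h ⊢
  rw [hT, hw]
  -- The new summand absorbs the weight change `(N+n)² - (N-n)² = 4Nn`.
  linear_combination h

theorem discreteChebyshev_sq_identity (N : ℕ) (x : ℝ) (n : ℕ) (hn : n + 2 ≤ N) :
    -x * (1 - x / N) * ∑ l ∈ Finset.range n,
        ((l : ℝ) + 1) *
          (4 * ((l : ℝ) + 1) / ((N : ℝ) - 1) * discreteChebyshevU l (x - 1) ((N : ℝ) - 2)) ^ 2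
      + discreteChebyshevT (n + 1) x N ^ 2
      + x / N * (1 - x / N) *
          (2 * ((n : ℝ) + 1) * ((N : ℝ) - n - 1) / ((N : ℝ) - 1)
            * discreteChebyshevU n (x - 1) ((N : ℝ) - 2)) ^ 2 = 1 := by
  have hN2 : (2 : ℝ) ≤ N := by exact_mod_cast (by omega : 2 ≤ N)
  have hN0 : (N : ℝ) ≠ 0 := by linarith
  have hN1 : (N : ℝ) - 1 ≠ 0 := by linarith
  induction n with
  | zero =>
    rw [discreteChebyshevU_zero, discreteChebyshevT_one _ _ hN0]
    simp
    field_simp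
    ring
  | succ m ih =>
    have ih := ih (by omega)
    rw [Finset.sum_range_succ]
    have hj : ∀ j ≤ m + 2, (N : ℝ) ≠ (j : ℝ) := fun j hj => by
      exact_mod_cast (by omega : N ≠ j)
    have hT := discreteChebyshevT_succ_succ m x N fun j h => hj j (by omega)
    have hU := discreteChebyshevU_shift_succ m x N hj
    rw [add_assoc (N : ℝ)] at hT hU
    rw [sub_sub] at ih
    have := sq_identity_step hN0 hN1 hT hU ih
    rw [show 2 * (((m + 1 : ℕ) : ℝ) + 1) * ((N : ℝ) - (m + 1 : ℕ) - 1) / ((N : ℝ) - 1)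
      * discreteChebyshevU (m + 1) (x - 1) ((N : ℝ) - 2) = 2 * ((m + 2) * (N - m - 2) / (N - 1)
      * discreteChebyshevU (m + 1) (x - 1) (N - 2)) by push_cast; ring]
    exact this

theorem discreteChebyshev_sq_identity_limit (N : ℕ) (x : ℝ) (n : ℕ) (hn : n + 1 = N) :
    ∃ L : ℝ,
      Tendsto (fun M : ℝ => (M - n - 1) / (M - 1) * discreteChebyshevU n (x - 1) (M - 2))
        (𝓝[≠] (N : ℝ)) (𝓝 L) ∧
      -x * (1 - x / N) * ∑ l ∈ Finset.range n,
          ((l : ℝ) + 1) *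
            (4 * ((l : ℝ) + 1) / ((N : ℝ) - 1) * discreteChebyshevU l (x - 1) ((N : ℝ) - 2)) ^ 2
        + discreteChebyshevT (n + 1) x N ^ 2
        + x / N * (1 - x / N) * (2 * ((n : ℝ) + 1) * L) ^ 2 = 1 := by
  subst hn
  cases n with
  | zero =>
    -- Here `N = 1`: the quotient is constantly 1 off `M = 1`, and the sum is empty.
    refine ⟨1, tendsto_const_nhds.congr' ?_, ?_⟩
    · filter_upwards [self_mem_nhdsWithin] with M hM
      have : M - 1 ≠ 0 := sub_ne_zero.2 (by simpa using hM)
      simp [discreteChebyshevU_zero, this]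
    · rw [discreteChebyshevT_one _ _ (by simp)]
      simp
      ring
  | succ m =>
    have hm : (0 : ℝ) ≤ m := Nat.cast_nonneg m
    set N : ℕ := m + 1 + 1 with hNdef
    have hNr : (N : ℝ) = m + 2 := by rw [hNdef]; push_cast; ring
    have hN0 : (N : ℝ) ≠ 0 := by linarith
    have hN1 : (N : ℝ) - 1 ≠ 0 := by linarith
    have hj : ∀ j ≤ m + 1, (N : ℝ) ≠ (j : ℝ) := fun j hj => by
      exact_mod_cast (by omega : N ≠ j)
    -- The right side of the second recurrence is regular at `M = N`, so it provides the limit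
    -- although `U_{m+1}(x-1, M-2)` has a zero denominator there.
    set G : ℝ → ℝ := fun M => discreteChebyshevT (m + 1) x M
      + (1 - 2 * x / M) * ((m + 1) * (M + m + 1) / (M - 1)) *
        discreteChebyshevU m (x - 1) (M - 2) with hG
    have hGc : ContinuousAt G N := by
      have h1 : ContinuousAt (fun M => discreteChebyshevT (m + 1) x M) (N : ℝ) :=
        continuousAt_hahnQ _ _ _ _ (by norm_num) fun j h => hj j (by omega)
      have h2 : ContinuousAt (fun M : ℝ => discreteChebyshevU m (x - 1) (M - 2)) (N : ℝ) :=
        ContinuousAt.comp (g := fun M => discreteChebyshevU m (x - 1) M) (f := fun M : ℝ => M - 2)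
          (continuousAt_hahnQ _ _ _ _ (by norm_num) fun j h h' =>
            hj (j + 2) (by omega) (by push_cast; linarith)) (by fun_prop)
      refine h1.add (ContinuousAt.mul (ContinuousAt.mul ?_ ?_) h2)
      · exact continuousAt_const.sub (continuousAt_const.div continuousAt_id hN0)
      · exact ContinuousAt.div (by fun_prop) (by fun_prop) hN1
    refine ⟨G N / (m + 2), ?_, ?_⟩
    · refine ((hGc.tendsto.mono_left nhdsWithin_le_nhds).div_const _).congr' ?_
      filter_upwards [self_mem_nhdsWithin,
        nhdsWithin_le_nhds (Metric.ball_mem_nhds (N : ℝ) one_pos)] with M hM hM'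
      -- A punctured unit ball around `N` contains no integer.
      have hMj : ∀ j ≤ m + 2, M ≠ (j : ℝ) := by
        rintro j hj rfl
        have hlt : j < N := lt_of_le_of_ne hj fun h => hM (by rw [h]; rfl)
        have : (j : ℝ) + 1 ≤ N := by exact_mod_cast hlt
        rw [Metric.mem_ball, Real.dist_eq, abs_lt] at hM'
        linarith [hM'.1]
      have hM1 : M - 1 ≠ 0 := sub_ne_zero.2 (by simpa using hMj 1 (by omega))
      rw [hG]
      simp only
      rw [← discreteChebyshevU_shift_succ m x M hMj]
      have : (m : ℝ) + 2 ≠ 0 := by linarith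
      push_cast
      field_simp
      ring
    · have ih := discreteChebyshev_sq_identity N x m le_rfl
      rw [Finset.sum_range_succ]
      have hT := discreteChebyshevT_succ_succ m x N hj
      have hU := congrFun hG N
      rw [add_assoc (N : ℝ)] at hT hU
      rw [sub_sub] at ih
      have := sq_identity_step hN0 hN1 hT hU ih
      have h2 : (m : ℝ) + 2 ≠ 0 := by linarith
      rw [show 2 * (((m + 1 : ℕ) : ℝ) + 1) * (G N / (m + 2)) = 2 * G N by
        push_cast; field_simp; ring]
      exact this

/-! ### Bounds from the growth of the quadratic form. -/

/-- The rotation step with a weight comparison. -/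
theorem rotation_step {T T' w y p q u C : ℝ} (hy : 0 ≤ 1 - y ^ 2) (hC : 1 ≤ C)
    (hT : T' = y * T - (1 - y ^ 2) * p * u) (hw : w = T + y * p * u) (hpq : |p| ≤ C * |q|) :
    T' ^ 2 + (1 - y ^ 2) * w ^ 2 ≤ C ^ 2 * (T ^ 2 + (1 - y ^ 2) * (q * u) ^ 2) := by
  have h1 : T' ^ 2 + (1 - y ^ 2) * w ^ 2 = T ^ 2 + (1 - y ^ 2) * (p * u) ^ 2 := by
    rw [hT, hw]; ring
  have h2 : p ^ 2 ≤ C ^ 2 * q ^ 2 := by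
    rw [← sq_abs p, ← sq_abs q, ← mul_pow]
    exact pow_le_pow_left₀ (abs_nonneg _) hpq 2
  have h3 : T ^ 2 ≤ C ^ 2 * T ^ 2 := le_mul_of_one_le_left (sq_nonneg _) (one_le_pow₀ hC)
  have h4 := mul_le_mul_of_nonneg_left h2 (mul_nonneg hy (sq_nonneg u))
  rw [h1]
  linarith

theorem one_sub_sq_nonneg {x N : ℝ} (hN : 0 < N) (h0 : 0 ≤ x) (h1 : x ≤ N) :
    0 ≤ 1 - (1 - 2 * x / N) ^ 2 := by
  have h2 : x / N ≤ 1 := (div_le_one hN).2 h1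
  have h3 : 0 ≤ x / N := div_nonneg h0 hN.le
  rw [mul_div_assoc]
  nlinarith

theorem discreteChebyshevT_weighted_bound (N : ℕ) (x : ℝ) (h0 : 0 ≤ x) (h1 : x ≤ N) (m : ℕ)
    (hm : m + 2 ≤ N) :
    discreteChebyshevT (m + 1) x N ^ 2 + (1 - (1 - 2 * x / N) ^ 2) *
      ((m + 1) * (N - m - 1) / (N - 1) * discreteChebyshevU m (x - 1) (N - 2)) ^ 2
      ≤ (∏ j ∈ Finset.range m, ((N : ℝ) + (j + 1)) / (N - (j + 1))) ^ 2 := by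
  have hN2 : (2 : ℝ) ≤ N := by exact_mod_cast (by omega : 2 ≤ N)
  have hN0 : (N : ℝ) ≠ 0 := by linarith
  have hN1 : (N : ℝ) - 1 ≠ 0 := by linarith
  induction m with
  | zero =>
    rw [discreteChebyshevU_zero, discreteChebyshevT_one _ _ hN0]
    simp [hN1]
  | succ m ih =>
    have hj : ∀ j ≤ m + 2, (N : ℝ) ≠ (j : ℝ) := fun j hj => by
      exact_mod_cast (by omega : N ≠ j)
    have hmN : (m : ℝ) + 3 ≤ N := by exact_mod_cast hm
    have hm0 : (0 : ℝ) ≤ m := Nat.cast_nonneg m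
    have hpos : 0 < (N : ℝ) - (m + 1) := by linarith
    -- `C` is the exact weight ratio `p/q`.
    have step := rotation_step (q := (m + 1) * (N - m - 1) / (N - 1))
      (C := ((N : ℝ) + (m + 1)) / (N - (m + 1)))
      (one_sub_sq_nonneg (by linarith) h0 h1) ((one_le_div hpos).2 (by linarith))
      (discreteChebyshevT_succ_succ m x N fun j h => hj j (by omega))
      (discreteChebyshevU_shift_succ m x N hj)
      (by
        rw [abs_of_nonneg, abs_of_nonneg]
        · apply le_of_eq
          field_simp
          ring
        · exact div_nonneg (mul_nonneg (by linarith) (by linarith)) (by linarith)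
        · exact div_nonneg (mul_nonneg (by linarith) (by linarith)) (by linarith))
    have bound := step.trans (mul_le_mul_of_nonneg_left (ih (by omega)) (sq_nonneg _))
    rw [Finset.prod_range_succ, mul_comm (Finset.prod _ _), mul_pow (_ / _) (Finset.prod _ _)]
    refine le_trans (le_of_eq ?_) bound
    push_cast
    ring

/-- The numerators agree factor by factor; the denominators agree after reversing their order. -/
theorem prod_Icc_eq_prod_range (N : ℝ) (m : ℕ) (h : ∀ j ≤ m, N ≠ (j : ℝ)) :
    ∏ j ∈ Finset.Icc 1 m, (1 + ((m + 1 : ℕ) : ℝ) / (N - (m + 1 : ℕ) + j))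
      = ∏ j ∈ Finset.range m, (N + (j + 1)) / (N - (j + 1)) := by
  have e1 : ∏ j ∈ Finset.Icc 1 m, (1 + ((m + 1 : ℕ) : ℝ) / (N - (m + 1 : ℕ) + j))
      = ∏ j ∈ Finset.range m, (N + (j + 1)) / (N - (m - j)) := by
    rw [← Finset.Ico_add_one_right_eq_Icc, Finset.prod_Ico_eq_prod_range, Nat.add_sub_cancel]
    refine Finset.prod_congr rfl fun j hj => ?_
    have hjm := Finset.mem_range.1 hj
    have : N - (m - j) ≠ 0 := fun h' => h (m - j) (by omega) (by
      rw [Nat.cast_sub hjm.le]; linarith)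
    push_cast
    rw [show N - (m + 1) + (1 + (j : ℝ)) = N - (m - j) by ring]
    field_simp
    ring
  rw [e1, Finset.prod_div_distrib, Finset.prod_div_distrib]
  congr 1
  rw [← Finset.prod_range_reflect]
  refine Finset.prod_congr rfl fun j hj => ?_
  have hjm := Finset.mem_range.1 hj
  rw [Nat.sub_sub, Nat.cast_sub (by omega)]
  push_cast
  ring

theorem abs_discreteChebyshevT_le (N : ℕ) (x : ℝ) (h0 : 0 ≤ x) (h1 : x ≤ N) (n : ℕ)
    (hn : n + 1 ≤ N) :
    |discreteChebyshevT n x N| ≤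
      ∏ j ∈ Finset.Icc 1 (n - 1), (1 + (n : ℝ) / ((N : ℝ) - n + j)) := by
  cases n with
  | zero => simp [discreteChebyshevT_zero]
  | succ m =>
    have hmN : (m : ℝ) + 2 ≤ N := by exact_mod_cast hn
    have hm0 : (0 : ℝ) ≤ m := Nat.cast_nonneg m
    rw [Nat.add_sub_cancel, prod_Icc_eq_prod_range _ _ fun j hj => by
      exact_mod_cast (by omega : N ≠ j)]
    refine abs_le_of_sq_le_sq (le_trans ?_ (discreteChebyshevT_weighted_bound N x h0 h1 m hn)) ?_
    · exact le_add_of_nonneg_right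
        (mul_nonneg (one_sub_sq_nonneg (by linarith) h0 h1) (sq_nonneg _))
    · refine Finset.prod_nonneg fun j hj => ?_
      have : (j : ℝ) + 1 ≤ m := by exact_mod_cast Finset.mem_range.1 hj
      exact div_nonneg (by positivity) (by linarith)

theorem discreteChebyshevU_weighted_bound (N : ℕ) (x : ℝ) (h0 : 0 ≤ x) (h1 : x ≤ N) (hN : 2 ≤ N)
    (m : ℕ) (hm : (m + 1) ^ 2 ≤ N + 1) :
    discreteChebyshevU (m + 1) x N ^ 2 + (1 - (1 - 2 * x / N) ^ 2) *
      ((m + 3) * (N - m - 1) / (3 * (N - 1)) * hahnQ m (x - 1) (3 / 2) (3 / 2) (N - 2)) ^ 2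
      ≤ 1 := by
  have hN2 : (2 : ℝ) ≤ N := by exact_mod_cast hN
  have hN0 : (N : ℝ) ≠ 0 := by linarith
  have hN1 : (N : ℝ) - 1 ≠ 0 := by linarith
  induction m with
  | zero =>
    rw [hahnQ_zero, discreteChebyshevU_one _ _ hN0]
    simp [hN1]
  | succ m ih =>
    -- The square condition alone keeps the degree below `N`, so no denominator vanishes.
    have hmlt : m + 2 < N := by nlinarith
    have hj : ∀ j ≤ m + 2, (N : ℝ) ≠ (j : ℝ) := fun j hj => by
      exact_mod_cast (by omega : N ≠ j)
    have hmN : ((m : ℝ) + 2) ^ 2 ≤ N + 1 := by exact_mod_cast hm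
    have hmN' : (m : ℝ) + 3 ≤ N := by exact_mod_cast hmlt
    have hm0 : (0 : ℝ) ≤ m := Nat.cast_nonneg m
    have r1 := hahnQ_succ_succ m x (1 / 2) N (by norm_num) fun j h => hj j (by omega)
    have r2 := hahnQ_shift_succ m x (1 / 2) N (by norm_num) hj
    rw [show (1 / 2 : ℝ) + 1 = 3 / 2 by norm_num,
      show 2 * (3 / 2 : ℝ) * (N - 1) = 3 * (N - 1) by ring] at r1 r2
    have step := rotation_step (q := (m + 3) * (N - m - 1) / (3 * (N - 1))) (C := 1)
      (one_sub_sq_nonneg (by linarith) h0 h1) le_rfl r1 r2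
      (by
        rw [abs_of_nonneg, abs_of_nonneg, one_mul]
        -- Expanded, `(m+1)(N+m+3) ≤ (m+3)(N-m-1)` is `(m+2)² ≤ N+1`.
        · exact div_le_div_of_nonneg_right (by nlinarith) (by linarith)
        · exact div_nonneg (mul_nonneg (by linarith) (by linarith)) (by linarith)
        · exact div_nonneg (mul_nonneg (by linarith) (by linarith)) (by linarith))
    rw [one_pow, one_mul] at step
    refine le_trans (le_of_eq ?_) (step.trans (ih (by nlinarith)))
    unfold discreteChebyshevU
    push_cast
    ring

theorem abs_discreteChebyshevU_le_one (N : ℕ) (x : ℝ) (h0 : 0 ≤ x) (h1 : x ≤ N) (n : ℕ)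
    (hn : n ≤ N) (hsq : n ^ 2 ≤ N + 1) : |discreteChebyshevU n x N| ≤ 1 := by
  cases n with
  | zero => simp [discreteChebyshevU_zero]
  | succ m =>
    have hN0 : (0 : ℝ) < N := by exact_mod_cast (by omega : 0 < N)
    have hs := one_sub_sq_nonneg hN0 h0 h1
    rw [← sq_le_one_iff_abs_le_one]
    rcases lt_or_ge N 2 with hN | hN
    -- For `N = 1` the companion weight would divide by `N - 1 = 0`, but only degree 1 remains.
    · obtain rfl : m = 0 := by omega
      rw [zero_add, discreteChebyshevU_one _ _ hN0.ne']
      linarith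
    · exact (le_add_of_nonneg_right (mul_nonneg hs (sq_nonneg _))).trans
        (discreteChebyshevU_weighted_bound N x h0 h1 hN m hsq)

/-- In the first conjunct `0 ≤ n ≤ N - 2`. The second conjunct is the same identity for
`n = N - 1`, where `(N - n - 1) U_n(x - 1, N - 2)` has the form `0 · ∞` and
`(N - n - 1) / (N - 1) · U_n(x - 1, N - 2)` is read as the limit of
`(M - n - 1) / (M - 1) · U_n(x - 1, M - 2)` as the real number `M` tends to `N`. -/
theorem corollary3p6 (N : ℕ) (x : ℝ) (hx : x ∈ Set.Icc (0 : ℝ) (N : ℝ)) :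
    (∀ n : ℕ, n + 2 ≤ N →
      -x * (1 - x / N) * ∑ l ∈ Finset.range n,
          ((l : ℝ) + 1) *
            (4 * ((l : ℝ) + 1) / ((N : ℝ) - 1) * discreteChebyshevU l (x - 1) ((N : ℝ) - 2)) ^ 2
        + discreteChebyshevT (n + 1) x N ^ 2
        + x / N * (1 - x / N) *
            (2 * ((n : ℝ) + 1) * ((N : ℝ) - n - 1) / ((N : ℝ) - 1)
              * discreteChebyshevU n (x - 1) ((N : ℝ) - 2)) ^ 2 = 1) ∧
    (∀ n : ℕ, n + 1 = N → ∃ L : ℝ,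
      Tendsto (fun M : ℝ => (M - n - 1) / (M - 1) * discreteChebyshevU n (x - 1) (M - 2))
        (𝓝[≠] (N : ℝ)) (𝓝 L) ∧
      -x * (1 - x / N) * ∑ l ∈ Finset.range n,
          ((l : ℝ) + 1) *
            (4 * ((l : ℝ) + 1) / ((N : ℝ) - 1) * discreteChebyshevU l (x - 1) ((N : ℝ) - 2)) ^ 2
        + discreteChebyshevT (n + 1) x N ^ 2
        + x / N * (1 - x / N) * (2 * ((n : ℝ) + 1) * L) ^ 2 = 1) ∧
    (∀ n : ℕ, n + 1 ≤ N →
      |discreteChebyshevT n x N| ≤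
        ∏ j ∈ Finset.Icc 1 (n - 1), (1 + (n : ℝ) / ((N : ℝ) - n + j))) ∧
    (∀ n : ℕ, n ≤ N → (n : ℝ) ≤ √((N : ℝ) + 1) → |discreteChebyshevU n x N| ≤ 1) := by
  refine ⟨discreteChebyshev_sq_identity N x, discreteChebyshev_sq_identity_limit N x,
    abs_discreteChebyshevT_le N x hx.1 hx.2, fun n hn hsq => ?_⟩
  refine abs_discreteChebyshevU_le_one N x hx.1 hx.2 n hn ?_
  have := (Real.le_sqrt (by positivity) (by positivity)).1 hsq
  exact_mod_cast this
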